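/- Let $Q$ be a quiver whose arrow set is partitioned into $n+1$ parts (arrow types). For a path $\gamma$ let $\mathfrak t_\gamma(\mathfrak a)$ be the number of arrows of type $\mathfrak a$ in $\gamma$; $\gamma$ is admissible if $\mathfrak t_\gamma(\mathfrak a)=0$ for some $\mathfrak a$, simple if $\mathfrak t_\gamma(\mathfrak a)\le 1$ for all $\mathfrak a$, and a minimal circuit if it is simple and not admissible. Assume $Q$ is a $\mathbb Z^n$-quiver: exactly one arrow of each type leaves each vertex; each vertex is connected to each other by an admissible path; two paths $\gamma_1,\gamma_2$ leaving the same vertex arrive at the same vertex if and only if $\mathfrak t_{\gamma_1}-\mathfrak t_{\gamma_2}$ is constant. Two distinct vertices connected by a simple path are neighbors; a polygon is a nonempty set of pairwise neighboring vertices. The hull $P(H)$ of a set $H$ of vertices is the set of vertices $v$ such that for each arrow type there is a path from some vertex of $H$ to $v$ containing no arrow of that type. Let $\mathfrak V$ be a representation of $Q$ in finite-dimensional vector spaces over a field $k$, with spaces $V_v$ and with map $\varphi_\gamma$ along each path $\gamma$. Assume that $\mathfrak V$ is - a linked net: (1) if $\gamma_1,\gamma_2$ connect the same two vertices and $\gamma_2$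 is admissible, then $\varphi_{\gamma_1}$ is a scalar multiple of $\varphi_{\gamma_2}$; (2) $\varphi_\gamma=0$ for each minimal circuit $\gamma$; (3) $\operatorname{Ker}\varphi_{\gamma_1}\cap\operatorname{Ker}\varphi_{\gamma_2}=0$ if $\gamma_1,\gamma_2$ are admissible, leave the same vertex and have no arrow type in common; - pure (each epimorphism between associated spaces is an isomorphism) and nontrivial (nonzero); - exact: $\operatorname{Im}\varphi_\gamma=\operatorname{Ker}\varphi_\delta$ for all neighbors $v,w$ and all admissible paths $\gamma$ from $v$ to $w$ and $\delta$ from $w$ to $v$; - finitely generated: there is a finite set $H$ of vertices generating $\mathfrak V$, that is, each $V_v$ is the sum of the images of the maps along paths from vertices of $H$ to $v$. Let $\mathbb{LP}(\mathfrak V)$ be the linked projective space, the scheme parameterizing subrepresentations of $\mathfrak V$ of pure dimension $1$. It is realized, for any finite set $H$ of vertices generating $\mathfrak V$ with $P(H)=H$, as the closed subscheme of $\prod_{v\in H}\mathbb P(V_v)$ ($\mathbb P(V_v)$ being the projective space of lines in $V_v$) given by $\varphi_\gamma(s_v)\wedge s_w=0$ for all $v,w\in H$ and all admissible paths $\gamma$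 from $v$ to $w$, a subrepresentation $\mathfrak W$ corresponding to the tuple of the lines $W_v$, $v\in H$. For each vertex $v$ of $Q$ let $\mathbb{LP}(\mathfrak V)_v^*$ be the set of points of $\mathbb{LP}(\mathfrak V)$ corresponding to subrepresentations (of $\mathfrak V\otimes_kK$, with $K$ an extension field of $k$) generated by $v$, and let $\mathbb{LP}(\mathfrak V)_v$ be its closure in $\mathbb{LP}(\mathfrak V)$. Let $m\ge 1$ and let $v_1,\dots,v_m$ be distinct vertices of $Q$. If $\mathbb{LP}(\mathfrak V)_{v_1}\cap\cdots\cap\mathbb{LP}(\mathfrak V)_{v_m}$ is nonempty, then $\{v_1,\dots,v_m\}$ is a polygon. -/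

import Mathlib

open CategoryTheory AlgebraicGeometry Limits
open scoped TensorProduct

universe u v w z

namespace LinkedNet

/-! ### Quivers with arrow types -/

section Quivers

variable {Q : Type v} [Quiver.{z} Q]

/-- A partition of the arrow set of `Q` in `n + 1` (numbered) parts: each arrow has a type. -/
abbrev ArrowTypes (Q : Type v) [Quiver.{z} Q] (n : ℕ) : Type (max v z) :=
  ∀ ⦃x y : Q⦄, (x ⟶ y) → Fin (n + 1)

variable {n : ℕ}

/-- The type of a path: the number of arrows of each type that it contains. -/
def pathType (τ : ArrowTypes Q n) {x : Q} : ∀ {y : Q}, Quiver.Path x y → Fin (n + 1) → ℕ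
  | _, .nil => fun _ => 0
  | _, .cons γ e => fun a => pathType τ γ a + if τ e = a then 1 else 0

/-- A path is admissible if it contains no arrow of some type. -/
def IsAdmissible (τ : ArrowTypes Q n) {x y : Q} (γ : Quiver.Path x y) : Prop :=
  ∃ a, pathType τ γ a = 0

/-- A path is simple if it contains at most one arrow of each type. -/
def IsSimplePath (τ : ArrowTypes Q n) {x y : Q} (γ : Quiver.Path x y) : Prop :=
  ∀ a, pathType τ γ a ≤ 1

/-- A minimal circuit is a simple non-admissible path. -/
def IsMinimalCircuit (τ : ArrowTypes Q n) {x y : Q} (γ : Quiver.Path x y) : Prop :=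
  IsSimplePath τ γ ∧ ¬ IsAdmissible τ γ

/-- The arrow types make `Q` a `ℤⁿ`-quiver. -/
structure IsZnQuiver (τ : ArrowTypes Q n) : Prop where
  existsUnique_arrow : ∀ (x : Q) (a : Fin (n + 1)), ∃! e : (Σ y : Q, x ⟶ y), τ e.2 = a
  exists_admissible : ∀ x y : Q, ∃ γ : Quiver.Path x y, IsAdmissible τ γ
  endpoint_eq_iff : ∀ {x y₁ y₂ : Q} (γ₁ : Quiver.Path x y₁) (γ₂ : Quiver.Path x y₂),
    y₁ = y₂ ↔ ∃ c : ℤ, ∀ a, (pathType τ γ₁ a : ℤ) - (pathType τ γ₂ a : ℤ) = c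

/-- Two distinct vertices connected by a simple path are neighbors. -/
def AreNeighbors (τ : ArrowTypes Q n) (x y : Q) : Prop :=
  x ≠ y ∧ ∃ γ : Quiver.Path x y, IsSimplePath τ γ

/-- A polygon is a nonempty collection of pairwise neighboring vertices. -/
def IsPolygon (τ : ArrowTypes Q n) (Δ : Set Q) : Prop :=
  Δ.Nonempty ∧ Δ.Pairwise (AreNeighbors τ)

/-- The hull `P(H)`: all vertices `y` such that for each arrow type there are `x ∈ H` and a path
from `x` to `y` without arrows of that type. -/
def hull (τ : ArrowTypes Q n) (H : Set Q) : Set Q :=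
  {y | ∀ a, ∃ x ∈ H, ∃ γ : Quiver.Path x y, pathType τ γ a = 0}

end Quivers

/-! ### Representations in vector spaces -/

/-- A representation of the quiver `Q` in the category of vector spaces over `k`. -/
structure QuiverRep (k : Type u) [Field k] (Q : Type v) [Quiver.{z} Q] where
  space : Q → Type w
  [addCommGroup : ∀ x, AddCommGroup (space x)]
  [module : ∀ x, Module k (space x)]
  map : ∀ ⦃x y : Q⦄, (x ⟶ y) → (space x →ₗ[k] space y)

attribute [instance] QuiverRep.addCommGroup QuiverRep.module

namespace QuiverRep

variable {k : Type u} [Field k] {Q : Type v} [Quiver.{z} Q] {n : ℕ}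

/-- The composition of the maps of the representation along a path. -/
def pathMap (V : QuiverRep.{u, v, w, z} k Q) {x : Q} :
    ∀ {y : Q}, Quiver.Path x y → (V.space x →ₗ[k] V.space y)
  | _, .nil => LinearMap.id
  | _, .cons γ e => V.map e ∘ₗ V.pathMap γ

/-- Each epimorphism between associated spaces is an isomorphism. -/
def IsPure (V : QuiverRep.{u, v, w, z} k Q) : Prop :=
  ∀ (x y : Q) (f : V.space x →ₗ[k] V.space y), Function.Surjective f → Function.Bijective f

/-- Some associated space is nonzero (equivalently, for pure `V`, all of them are). -/
def IsNontrivial (V : QuiverRep.{u, v, w, z} k Q) : Prop :=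
  ∃ x, Nontrivial (V.space x)

structure IsWeaklyLinkedNet (τ : ArrowTypes Q n) (V : QuiverRep.{u, v, w, z} k Q) : Prop where
  scalar_multiple : ∀ {x y : Q} (γ₁ γ₂ : Quiver.Path x y), IsAdmissible τ γ₂ →
    ∃ c : k, V.pathMap γ₁ = c • V.pathMap γ₂
  minimalCircuit : ∀ {x y : Q} (γ : Quiver.Path x y), IsMinimalCircuit τ γ → V.pathMap γ = 0

structure IsLinkedNet (τ : ArrowTypes Q n) (V : QuiverRep.{u, v, w, z} k Q) : Prop
    extends IsWeaklyLinkedNet τ V where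
  ker_inf_ker : ∀ {x y₁ y₂ : Q} (γ₁ : Quiver.Path x y₁) (γ₂ : Quiver.Path x y₂),
    IsAdmissible τ γ₁ → IsAdmissible τ γ₂ →
    (∀ a, pathType τ γ₁ a = 0 ∨ pathType τ γ₂ a = 0) →
    LinearMap.ker (V.pathMap γ₁) ⊓ LinearMap.ker (V.pathMap γ₂) = ⊥

/-- `Im φ^x_y = Ker φ^y_x` for each two neighbors `x`, `y`, where `φ^x_y` is the map along
any admissible path from `x` to `y`. -/
def IsExact (τ : ArrowTypes Q n) (V : QuiverRep.{u, v, w, z} k Q) : Prop :=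
  ∀ x y : Q, AreNeighbors τ x y → ∀ (γ : Quiver.Path x y) (δ : Quiver.Path y x),
    IsAdmissible τ γ → IsAdmissible τ δ →
    LinearMap.range (V.pathMap γ) = LinearMap.ker (V.pathMap δ)

/-- `V` is generated by `H`: each `V_y` is the sum of the images of the maps along
(finitely many) paths from vertices of `H` to `y`. -/
def GeneratedBy (V : QuiverRep.{u, v, w, z} k Q) (H : Set Q) : Prop :=
  ∀ y : Q, (⨆ x ∈ H, ⨆ γ : Quiver.Path x y, LinearMap.range (V.pathMap γ)) = ⊤

def IsFinitelyGenerated (V : QuiverRep.{u, v, w, z} k Q) : Prop :=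
  ∃ H : Set Q, H.Finite ∧ V.GeneratedBy H

/-- Extension of scalars. -/
def baseChange (V : QuiverRep.{u, v, w, z} k Q) (K : Type u) [Field K] [Algebra k K] :
    QuiverRep.{u, v, max u w, z} K Q where
  space x := K ⊗[k] V.space x
  map _ _ e := (V.map e).baseChange K

/-- A subrepresentation: subspaces preserved by the maps along all arrows. -/
structure Subrep (V : QuiverRep.{u, v, w, z} k Q) where
  space : ∀ x, Submodule k (V.space x)
  map_mem : ∀ ⦃x y : Q⦄ (e : x ⟶ y), ∀ s ∈ space x, V.map e s ∈ space y

/-- A subrepresentation as a representation. -/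
def Subrep.toRep {V : QuiverRep.{u, v, w, z} k Q} (W : V.Subrep) : QuiverRep.{u, v, w, z} k Q where
  space x := W.space x
  map x y e := (V.map e).restrict (p := W.space x) (q := W.space y) (W.map_mem e)

/-- The subrepresentation has pure dimension `1`. -/
def Subrep.IsPureDimOne {V : QuiverRep.{u, v, w, z} k Q} (W : V.Subrep) : Prop :=
  ∀ x, Module.finrank k (W.space x) = 1

end QuiverRep

/-! ### Products of projective spaces -/

noncomputable section Projective

variable (k : Type u) [Field k] (E : Type w) [AddCommGroup E] [Module k E] [Module.Finite k E]

/-- The grading by degree of the ring of polynomial functions on `E`, written in the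
coordinates of a basis. -/
abbrev coordGrading :
    ℕ → Submodule k (MvPolynomial (Fin (Module.finrank k E)) k) :=
  MvPolynomial.homogeneousSubmodule (Fin (Module.finrank k E)) k

instance : GradedAlgebra (coordGrading k E) :=
  MvPolynomial.gradedAlgebra

/-- The projective space `ℙ(E)` of lines in `E`, as a scheme over `Spec k`. -/
def projSpace : Over (Spec (CommRingCat.of k)) :=
  Over.mk (Proj.toSpecZero (coordGrading k E) ≫
    Spec.map (CommRingCat.ofHom (algebraMap k (coordGrading k E 0))))

/-- The spectrum of an extension field `K` of `k`, as a scheme over `Spec k`. -/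
def specOver (K : Type u) [Field K] [Algebra k K] : Over (Spec (CommRingCat.of k)) :=
  Over.mk (Spec.map (CommRingCat.ofHom (algebraMap k K)))

variable {k E}

/-- Evaluation of the polynomial functions on `E` at a vector of `K ⊗ E`. -/
def evalAt {K : Type u} [Field K] [Algebra k K] (s : K ⊗[k] E) :
    MvPolynomial (Fin (Module.finrank k E)) k →ₐ[k] K :=
  MvPolynomial.aeval fun i => ((Module.finBasis k E).baseChange K).repr s i

/-- The same evaluation with values in the global functions on `Spec K`. -/
def evalAtΓ {K : Type u} [Field K] [Algebra k K] (s : K ⊗[k] E) :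
    MvPolynomial (Fin (Module.finrank k E)) k →+* Γ(Spec (CommRingCat.of K), ⊤) :=
  (Scheme.ΓSpecIso (CommRingCat.of K)).inv.hom.comp (evalAt s).toRingHom

theorem map_irrelevant_evalAtΓ {K : Type u} [Field K] [Algebra k K] (s : K ⊗[k] E) (hs : s ≠ 0) :
    (HomogeneousIdeal.irrelevant (coordGrading k E)).toIdeal.map (evalAtΓ s) = ⊤ := by
  obtain ⟨i, hi⟩ : ∃ i, ((Module.finBasis k E).baseChange K).repr s i ≠ 0 := by
    by_contra! h
    exact hs (((Module.finBasis k E).baseChange K).repr.map_eq_zero_iff.mp (Finsupp.ext h))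
  refine Ideal.eq_top_of_isUnit_mem _ (Ideal.mem_map_of_mem _ (x := MvPolynomial.X i) ?_) ?_
  · exact HomogeneousIdeal.mem_irrelevant_of_mem _ one_pos
      ((MvPolynomial.mem_homogeneousSubmodule 1 _).mpr (MvPolynomial.isHomogeneous_X k i))
  · have : IsUnit (evalAt s (MvPolynomial.X i : MvPolynomial _ k)) := by
      simpa [evalAt] using hi
    exact this.map (Scheme.ΓSpecIso (CommRingCat.of K)).inv.hom

/-- The `K`-valued point `[s]` of `ℙ(E)` given by a nonzero vector `s` of `K ⊗ E`. -/
def linePoint {K : Type u} [Field K] [Algebra k K] (s : K ⊗[k] E) (hs : s ≠ 0) :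
    specOver k K ⟶ projSpace k E :=
  Over.homMk (Proj.fromOfGlobalSections (coordGrading k E) (evalAtΓ s)
    (map_irrelevant_evalAtΓ s hs)) (by
      simp only [projSpace, specOver, Over.mk_hom, Over.mk_left]
      rw [Proj.fromOfGlobalSections_toSpecZero_assoc, ← Spec.map_comp, ← CommRingCat.ofHom_comp]
      have h : ((evalAtΓ s).comp (algebraMap (coordGrading k E 0) _)).comp
          (algebraMap k (coordGrading k E 0)) =
          (Scheme.ΓSpecIso (CommRingCat.of K)).inv.hom.comp (algebraMap k K) := by
        ext c
        exact congrArg (Scheme.ΓSpecIso (CommRingCat.of K)).inv.hom ((evalAt s).commutes c)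
      rw [h, CommRingCat.ofHom_comp, Spec.map_comp, CommRingCat.ofHom_hom]
      rw [← Category.assoc, toSpecΓ_SpecMap_ΓSpecIso_inv, Category.id_comp])

end Projective

/-! ### The linked projective space -/

noncomputable section LinkedProjectiveSpace

variable {k : Type u} [Field k] {Q : Type v} [Quiver.{z} Q] {n : ℕ}
variable (V : QuiverRep.{u, v, w, z} k Q) [∀ x, Module.Finite k (V.space x)]

/-- The product over `Spec k` of the projective spaces `ℙ(V_x)` for `x ∈ H`. -/
def projProduct (H : Finset Q) : Over (Spec (CommRingCat.of k)) :=
  ∏ᶜ fun x : H => projSpace k (V.space x)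

/-- A tuple of nonzero vectors of the spaces `K ⊗ V_x` for `x ∈ H`. -/
structure Tuple (H : Finset Q) (K : Type u) [Field K] [Algebra k K] where
  vec : ∀ x : H, (V.baseChange K).space x
  ne_zero : ∀ x, vec x ≠ 0

variable {V}

/-- The `K`-valued point of the product of projective spaces given by a tuple. -/
def Tuple.toHom {H : Finset Q} {K : Type u} [Field K] [Algebra k K] (s : Tuple V H K) :
    specOver k K ⟶ projProduct V H :=
  Pi.lift fun x : H => linePoint (E := V.space x) (s.vec x) (s.ne_zero x)

/-- The point of the underlying space of the product of projective spaces at which the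
`K`-valued point of a tuple is supported. -/
def Tuple.point {H : Finset Q} {K : Type u} [Field K] [Algebra k K] (s : Tuple V H K) :
    (projProduct V H).left :=
  s.toHom.left (IsLocalRing.closedPoint K)

/-- The equations `φ^x_y(s_x) ∧ s_y = 0` for all `x, y ∈ H`: as `s_y ≠ 0`, they say that
`φ^x_y(s_x)` is a multiple of `s_y`. -/
def Tuple.IsLinked (τ : ArrowTypes Q n) {H : Finset Q} {K : Type u} [Field K] [Algebra k K]
    (s : Tuple V H K) : Prop :=
  ∀ (x y : H) (γ : Quiver.Path (x : Q) (y : Q)), IsAdmissible τ γ →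
    (V.baseChange K).pathMap γ (s.vec x) ∈ Submodule.span K {s.vec y}

variable (V)

/-- The underlying topological space of the closed subscheme `𝕃ℙ_H(V)` of the product of the
projective spaces `ℙ(V_x)`, `x ∈ H`: the points (of the scheme, not only the `k`-rational or
the closed ones) at which the equations `φ^x_y(s_x) ∧ s_y = 0` hold, with the Zariski topology. -/
def LPLocus (τ : ArrowTypes Q n) (H : Finset Q) : Set (projProduct V H).left :=
  {p | ∃ (K : Type u) (_ : Field K) (_ : Algebra k K) (s : Tuple V H K),
    s.IsLinked τ ∧ s.point = p}

/-- The locus `𝕃ℙ(V)_x^*` of the points of `𝕃ℙ(V)`, seen in `𝕃ℙ_H(V)`, that correspond to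
subrepresentations generated by the vertex `x`. A subrepresentation `W` of pure dimension `1`
of `K ⊗ V` corresponds to the `K`-valued point given by generators of the `W_y`, `y ∈ H`. -/
def LPOpen (τ : ArrowTypes Q n) (H : Finset Q) (x : Q) : Set (LPLocus V τ H) :=
  {p | ∃ (K : Type u) (_ : Field K) (_ : Algebra k K) (s : Tuple V H K),
    s.point = p.1 ∧ ∃ W : (V.baseChange K).Subrep, W.IsPureDimOne ∧
      (∀ y : H, W.space y = Submodule.span K {s.vec y}) ∧ W.toRep.GeneratedBy {x}}

/-- The closure `𝕃ℙ(V)_x` of `𝕃ℙ(V)_x^*` in `𝕃ℙ(V)`, seen in `𝕃ℙ_H(V)`. -/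
def LPComponent (τ : ArrowTypes Q n) (H : Finset Q) (x : Q) : Set (LPLocus V τ H) :=
  closure (LPOpen V τ H x)

end LinkedProjectiveSpace

end LinkedNet

/-!
It suffices to treat two distinct vertices `x` and `y` whose components share a point, and to show
that they are neighbors.

Suppose they are not. An admissible path from `x` to `y` then has some arrow type at least twice.
Follow from `x` one arrow of each type occurring in that path: this leads to a vertex `u` which
reaches `x` and `y` along admissible paths `α` and `β` of positive length without a common arrow
type (`IsZnQuiver.exists_separating_vertex`), so that `Ker φ_α ∩ Ker φ_β = 0`.

Circuits of positive length have zero map (`IsWeaklyLinkedNet.comp_pathMap_eq_zero`). Hence, if a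
subrepresentation `W` is generated by `x`, then `φ_α` kills `W_u`, and if it is generated by `y`,
then `φ_β` kills `W_u`. Both are closed conditions, so at a common point of the two components the
line at `u` lies in `Ker φ_α ∩ Ker φ_β = 0`, which is absurd.

As `u` need not belong to `H`, the line at `u` has to be expressed by the lines at the vertices of
`H`. Since `H` is equal to its hull, it contains a vertex `w`, the shadow of `u`, through which all
vertices of `H` reach `u` along admissible paths (`IsZnQuiver.exists_shadow`). Since `H` generates
`V` and `V` is pure, the map from `V_w` to `V_u` is bijective
(`QuiverRep.exists_bijective_pathMap`), and the line at `u` is the image of the line at `w`. The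
conditions above thus become the vanishing of linear maps on the line at `w`, which is closed in the
product of projective spaces (`isClosed_vanishingLocus`, `LPComponent_subset_vanishingLocus`).
-/

namespace LinkedNet

/-! ### Paths in a `ℤⁿ`-quiver -/

section Paths

variable {Q : Type v} [Quiver.{z} Q] {n : ℕ} {τ : ArrowTypes Q n}

theorem pathType_comp (τ : ArrowTypes Q n) {x y : Q} (γ : Quiver.Path x y) :
    ∀ {y' : Q} (δ : Quiver.Path y y') (a : Fin (n + 1)),
      pathType τ (γ.comp δ) a = pathType τ γ a + pathType τ δ a
  | _, .nil, a => by simp [pathType]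
  | _, .cons δ e, a => by
    simp only [Quiver.Path.comp_cons, pathType, pathType_comp τ γ δ a]
    ring

theorem pathType_nil (τ : ArrowTypes Q n) (x : Q) (a : Fin (n + 1)) :
    pathType τ (.nil : Quiver.Path x x) a = 0 := rfl

namespace IsZnQuiver

theorem exists_path (hQ : IsZnQuiver τ) (x : Q) (t : Fin (n + 1) → ℕ) :
    ∃ (y : Q) (γ : Quiver.Path x y), pathType τ γ = t := by
  induction h : ∑ a, t a generalizing t with
  | zero =>
    refine ⟨x, .nil, funext fun a => ?_⟩
    exact ((Finset.sum_eq_zero_iff.mp h) a (Finset.mem_univ a)).symm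
  | succ s ih =>
    obtain ⟨a, -, ha⟩ : ∃ a ∈ Finset.univ, t a ≠ 0 :=
      Finset.exists_ne_zero_of_sum_ne_zero (by omega)
    have ht : t = (t - Pi.single a 1) + Pi.single a 1 := by
      funext b
      rcases eq_or_ne b a with rfl | hb
      · simp; omega
      · simp [hb]
    have hs : ∑ b, (t - Pi.single a 1 : Fin (n + 1) → ℕ) b = s := by
      have := congrArg (fun f : Fin (n + 1) → ℕ => ∑ b, f b) ht
      simp only [Pi.add_apply, Finset.sum_add_distrib, Finset.sum_pi_single',
        Finset.mem_univ, if_true] at this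
      omega
    obtain ⟨y, γ, hγ⟩ := ih _ hs
    obtain ⟨⟨y', e⟩, he, -⟩ := hQ.existsUnique_arrow y a
    refine ⟨y', γ.cons e, funext fun b => ?_⟩
    rw [ht]
    simp only at he
    simp [pathType, hγ, he, Pi.single_apply, eq_comm]

theorem target_eq (hQ : IsZnQuiver τ) {x y₁ y₂ : Q} (γ₁ : Quiver.Path x y₁)
    (γ₂ : Quiver.Path x y₂) (c : ℕ) (h : ∀ a, pathType τ γ₁ a = pathType τ γ₂ a + c) : y₁ = y₂ :=
  (hQ.endpoint_eq_iff γ₁ γ₂).2 ⟨c, fun a => by rw [h a]; push_cast; ring⟩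

/-- The type of a circuit is constant. -/
theorem exists_pathType_eq (hQ : IsZnQuiver τ) {x : Q} (γ : Quiver.Path x x) :
    ∃ c : ℕ, ∀ a, pathType τ γ a = c := by
  obtain ⟨c, hc⟩ := (hQ.endpoint_eq_iff γ .nil).1 rfl
  refine ⟨c.toNat, fun a => ?_⟩
  have := hc a
  simp only [pathType_nil] at this
  omega

/-- Up to multiples of `(1, …, 1)`, each decomposition of the type of a path is realized by a
factorization of another path with the same ends. -/
theorem exists_factorization (hQ : IsZnQuiver τ) {x y : Q} (γ : Quiver.Path x y)
    (t₁ t₂ : Fin (n + 1) → ℕ) (c : ℕ) (h : ∀ a, t₁ a + t₂ a = pathType τ γ a + c) :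
    ∃ (u : Q) (α : Quiver.Path x u) (β : Quiver.Path u y),
      pathType τ α = t₁ ∧ pathType τ β = t₂ := by
  obtain ⟨u, α, hα⟩ := hQ.exists_path x t₁
  obtain ⟨y', β, hβ⟩ := hQ.exists_path u t₂
  obtain rfl : y' = y :=
    hQ.target_eq (α.comp β) γ c fun a => by rw [pathType_comp, hα, hβ, h]
  exact ⟨u, α, β, hα, hβ⟩

theorem exists_path_to (hQ : IsZnQuiver τ) (y : Q) (t : Fin (n + 1) → ℕ) :
    ∃ (x : Q) (γ : Quiver.Path x y), pathType τ γ = t := by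
  obtain ⟨x, -, γ, -, hγ⟩ := hQ.exists_factorization (.nil : Quiver.Path y y)
    (fun a => ∑ b, t b - t a) t (∑ b, t b) fun a => by
      have := Finset.single_le_sum (f := t) (fun _ _ => Nat.zero_le _) (Finset.mem_univ a)
      rw [pathType_nil]
      omega
  exact ⟨x, γ, hγ⟩

theorem source_eq (hQ : IsZnQuiver τ) {x₁ x₂ y : Q} (γ₁ : Quiver.Path x₁ y)
    (γ₂ : Quiver.Path x₂ y) (h : pathType τ γ₁ = pathType τ γ₂) : x₁ = x₂ := by
  -- A path from `y` whose type complements the common type to a constant returns to both sources.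
  let t : Fin (n + 1) → ℕ := fun a => ∑ b, pathType τ γ₁ b - pathType τ γ₁ a
  have ht : ∀ a, pathType τ γ₁ a + t a = ∑ b, pathType τ γ₁ b := fun a => by
    have := Finset.single_le_sum (f := pathType τ γ₁) (fun _ _ => Nat.zero_le _)
      (Finset.mem_univ a)
    simp only [t]
    omega
  obtain ⟨y', δ, hδ⟩ := hQ.exists_path y t
  have h₁ : y' = x₁ := hQ.target_eq (γ₁.comp δ) .nil (∑ b, pathType τ γ₁ b) fun a => by
    rw [pathType_comp, hδ, ht, pathType_nil, zero_add]
  have h₂ : y' = x₂ := hQ.target_eq (γ₂.comp δ) .nil (∑ b, pathType τ γ₁ b) fun a => by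
    rw [pathType_comp, hδ, ← h, ht, pathType_nil, zero_add]
  exact h₁.symm.trans h₂

/-- For a nonempty finite set `H` equal to its hull, each vertex `u` has a shadow `w` in `H`:
a vertex of `H` through which each vertex of `H` reaches `u` along an admissible path. -/
theorem exists_shadow (hQ : IsZnQuiver τ) (H : Finset Q) (hH : hull τ (H : Set Q) = H)
    (hne : H.Nonempty) (u : Q) :
    ∃ w ∈ H, ∃ σ : Quiver.Path w u, ∀ x ∈ H, ∃ ρ : Quiver.Path x w,
      IsAdmissible τ (ρ.comp σ) := by
  choose D hD using fun x => hQ.exists_admissible x u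
  -- The shadow is the vertex from which `u` is reached by a path whose type is the
  -- componentwise minimum of the types of admissible paths from the vertices of `H` to `u`.
  let μ : Fin (n + 1) → ℕ := fun a => H.inf' hne fun x => pathType τ (D x) a
  have hμ : ∀ x ∈ H, ∀ a, μ a ≤ pathType τ (D x) a := fun x hx a =>
    Finset.inf'_le (fun x => pathType τ (D x) a) hx
  obtain ⟨w, σ, hσ⟩ := hQ.exists_path_to u μ
  have key : ∀ x ∈ H, ∃ ρ : Quiver.Path x w, ∀ a, pathType τ ρ a + μ a = pathType τ (D x) a := by
    intro x hx
    obtain ⟨w', ρ, σ', hρ, hσ'⟩ := hQ.exists_factorization (D x)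
      (fun a => pathType τ (D x) a - μ a) μ 0 fun a => by have := hμ x hx a; omega
    obtain rfl : w' = w := hQ.source_eq σ' σ (hσ'.trans hσ.symm)
    exact ⟨ρ, fun a => by have := hμ x hx a; rw [hρ]; dsimp only; omega⟩
  have hw : w ∈ H := by
    rw [← Finset.mem_coe, ← hH]
    intro a
    obtain ⟨x, hx, hxa⟩ := Finset.exists_mem_eq_inf' hne fun x => pathType τ (D x) a
    obtain ⟨ρ, hρ⟩ := key x hx
    refine ⟨x, hx, ρ, ?_⟩
    have h₁ := hρ a
    have h₂ : μ a = pathType τ (D x) a := hxa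
    omega
  refine ⟨w, hw, σ, fun x hx => ?_⟩
  obtain ⟨ρ, hρ⟩ := key x hx
  obtain ⟨a, ha⟩ := hD x
  exact ⟨ρ, a, by rw [pathType_comp, hσ, hρ, ha]⟩

/-- Two distinct vertices `x`, `y` that are not neighbors are separated by a vertex `u`, from which
they are reached by admissible paths of positive length without a common arrow type. -/
theorem exists_separating_vertex (hQ : IsZnQuiver τ) {x y : Q} (hxy : x ≠ y)
    (h : ¬ AreNeighbors τ x y) :
    ∃ (u : Q) (α : Quiver.Path u x) (β : Quiver.Path u y),
      IsAdmissible τ α ∧ IsAdmissible τ β ∧ pathType τ α ≠ 0 ∧ pathType τ β ≠ 0 ∧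
      ∀ a, pathType τ α a = 0 ∨ pathType τ β a = 0 := by
  obtain ⟨γ, b₀, hb₀⟩ := hQ.exists_admissible x y
  obtain ⟨b, hb⟩ : ∃ b, 2 ≤ pathType τ γ b := by
    by_contra! hs
    exact h ⟨hxy, γ, fun a => Nat.le_of_lt_succ (hs a)⟩
  -- `u` is the end of a path from `x` with exactly one arrow of each type occurring in `γ`.
  obtain ⟨u, ε, β, hε, hβ⟩ := hQ.exists_factorization γ (fun a => min 1 (pathType τ γ a))
    (fun a => pathType τ γ a - 1) 0 fun a => by omega
  obtain ⟨x', α, hα⟩ := hQ.exists_path u fun a => 1 - pathType τ γ a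
  obtain rfl : x' = x := hQ.target_eq (ε.comp α) .nil 1 fun a => by
    rw [pathType_comp, hε, hα, pathType_nil]
    dsimp only
    omega
  refine ⟨u, α, β, ⟨b, by rw [hα]; dsimp only; omega⟩,
    ⟨b₀, by rw [hβ]; dsimp only; omega⟩, fun h0 => ?_, fun h0 => ?_,
    fun a => by rw [hα, hβ]; dsimp only; omega⟩
  · have := congrFun h0 b₀
    rw [hα, Pi.zero_apply] at this
    dsimp only at this
    omega
  · have := congrFun h0 b
    rw [hβ, Pi.zero_apply] at this
    dsimp only at this
    omega

end IsZnQuiver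

end Paths

/-! ### Maps along paths -/

namespace QuiverRep

variable {k : Type u} [Field k] {Q : Type v} [Quiver.{z} Q] {n : ℕ} {τ : ArrowTypes Q n}
variable {V : QuiverRep.{u, v, w, z} k Q}

theorem pathMap_comp (V : QuiverRep.{u, v, w, z} k Q) {x y : Q} (γ : Quiver.Path x y) :
    ∀ {y' : Q} (δ : Quiver.Path y y'),
      V.pathMap (γ.comp δ) = V.pathMap δ ∘ₗ V.pathMap γ
  | _, .nil => rfl
  | _, .cons δ e => by
    simp only [Quiver.Path.comp_cons, pathMap, pathMap_comp V γ δ, LinearMap.comp_assoc]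

theorem pathMap_baseChange (V : QuiverRep.{u, v, w, z} k Q) (K : Type u) [Field K] [Algebra k K]
    {x : Q} : ∀ {y : Q} (γ : Quiver.Path x y),
      (V.baseChange K).pathMap γ = (V.pathMap γ).baseChange K
  | _, .nil => LinearMap.baseChange_id.symm
  | _, .cons γ e => by
    simp only [pathMap, LinearMap.baseChange_comp, pathMap_baseChange V K γ]
    rfl

theorem Subrep.coe_pathMap_toRep (W : V.Subrep) {x : Q} :
    ∀ {y : Q} (γ : Quiver.Path x y) (s : W.space x),
      (W.space y).subtype (W.toRep.pathMap γ s) = V.pathMap γ s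
  | _, .nil, _ => rfl
  | _, .cons γ e, s => congrArg (V.map e) (Subrep.coe_pathMap_toRep W γ s)

theorem Subrep.pathMap_mem (W : V.Subrep) {x y : Q} (γ : Quiver.Path x y) (s : V.space x)
    (hs : s ∈ W.space x) : V.pathMap γ s ∈ W.space y := by
  have h := W.coe_pathMap_toRep γ ⟨s, hs⟩
  rw [← h]
  exact Subtype.property _

/-- A linear map that kills all vectors coming from `x` vanishes on each space of a
subrepresentation generated by `x`. -/
theorem Subrep.apply_eq_zero_of_generatedBy {W : V.Subrep} {x y : Q}
    (hW : W.toRep.GeneratedBy {x}) {F : Type*} [AddCommGroup F] [Module k F]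
    (f : V.space y →ₗ[k] F) (hf : ∀ γ : Quiver.Path x y, f ∘ₗ V.pathMap γ = 0)
    (s : V.space y) (hs : s ∈ W.space y) : f s = 0 := by
  have hle : (⊤ : Submodule k (W.toRep.space y)) ≤
      LinearMap.ker (f ∘ₗ (W.space y).subtype : W.space y →ₗ[k] F) := by
    rw [← hW y]
    refine iSup₂_le fun x' hx' => iSup_le fun γ => ?_
    obtain rfl : x' = x := hx'
    rintro _ ⟨t, rfl⟩
    have h := LinearMap.congr_fun (hf γ) ((W.space x').subtype t)
    exact (congrArg f (W.coe_pathMap_toRep γ t)).trans h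
  exact hle (x := ⟨s, hs⟩) trivial

/-- A path that is not admissible maps to zero: its shortest non-admissible initial part can be
rearranged, up to a scalar, so as to end with a minimal circuit. -/
theorem IsWeaklyLinkedNet.pathMap_eq_zero (hQ : IsZnQuiver τ) (hV : V.IsWeaklyLinkedNet τ)
    {x : Q} : ∀ {y : Q} (γ : Quiver.Path x y), ¬ IsAdmissible τ γ → V.pathMap γ = 0
  | _, .nil, h => absurd ⟨0, rfl⟩ h
  | _, .cons γ e, h => by
    by_cases hγ : IsAdmissible τ γ
    · obtain ⟨a, ha⟩ := hγ
      have hea : τ e = a := by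
        by_contra hea
        exact h ⟨a, by simp [pathType, ha, hea]⟩
      have hpos : ∀ b, b ≠ a → pathType τ γ b ≠ 0 := fun b hb h0 =>
        h ⟨b, by simp [pathType, h0, hea, hb.symm]⟩
      -- `γ` is rearranged so as to end with one arrow of each type other than `a`; together with
      -- `e` these form a minimal circuit.
      obtain ⟨u, α, β, hα, hβ⟩ := hQ.exists_factorization γ
        (fun b => pathType τ γ b - 1) (fun b => if b = a then 0 else 1) 0 fun b => by
          split_ifs with hb
          · subst hb; omega
          · have := hpos b hb; omega
      have hadm : IsAdmissible τ (α.comp β) := ⟨a, by simp [pathType_comp, hα, hβ, ha]⟩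
      have htype : ∀ b, pathType τ (β.cons e) b = 1 := fun b => by
        by_cases hb : b = a
        · simp [pathType, hβ, hb, hea]
        · simp [pathType, hβ, hb, hea, Ne.symm hb]
      have hzero : V.map e ∘ₗ V.pathMap β = 0 :=
        hV.minimalCircuit (β.cons e) ⟨fun b => (htype b).le, fun ⟨b, hb⟩ => by simp [htype] at hb⟩
      obtain ⟨c, hc⟩ := hV.scalar_multiple γ (α.comp β) hadm
      rw [pathMap, hc, pathMap_comp, LinearMap.comp_smul, ← LinearMap.comp_assoc, hzero,
        LinearMap.zero_comp, smul_zero]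
    · rw [pathMap, hV.pathMap_eq_zero hQ γ hγ, LinearMap.comp_zero]

theorem IsWeaklyLinkedNet.comp_pathMap_eq_zero (hQ : IsZnQuiver τ) (hV : V.IsWeaklyLinkedNet τ)
    {x u : Q} (α : Quiver.Path u x) (hα : pathType τ α ≠ 0) (γ : Quiver.Path x u) :
    V.pathMap α ∘ₗ V.pathMap γ = 0 := by
  rw [← pathMap_comp]
  refine hV.pathMap_eq_zero hQ _ fun ⟨a, ha⟩ => hα (funext fun b => ?_)
  obtain ⟨c, hc⟩ := hQ.exists_pathType_eq (γ.comp α)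
  have := hc b
  rw [← hc a, ha, pathType_comp] at this
  rw [Pi.zero_apply]
  omega

/-- If `V` is generated by a set equal to its hull, the map from the shadow of a vertex is
bijective. -/
theorem exists_bijective_pathMap (hQ : IsZnQuiver τ) (hV : V.IsWeaklyLinkedNet τ)
    (hpure : V.IsPure) (H : Finset Q) (hH : hull τ (H : Set Q) = H)
    (hgen : V.GeneratedBy (H : Set Q)) (hne : H.Nonempty) (u : Q) :
    ∃ w ∈ H, ∃ σ : Quiver.Path w u, Function.Bijective (V.pathMap σ) := by
  obtain ⟨w, hw, σ, hσ⟩ := hQ.exists_shadow H hH hne u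
  refine ⟨w, hw, σ, hpure w u _ (LinearMap.range_eq_top.mp (top_le_iff.mp ?_))⟩
  rw [← hgen u]
  refine iSup₂_le fun x hx => iSup_le fun γ => ?_
  obtain ⟨ρ, hρ⟩ := hσ x hx
  obtain ⟨c, hc⟩ := hV.scalar_multiple γ _ hρ
  rw [hc, pathMap_comp, ← LinearMap.comp_smul]
  exact LinearMap.range_comp_le_range _ _

end QuiverRep

/-! ### Closed conditions on points of products of projective spaces -/

section LinearForms

variable {k : Type u} [Field k] {E : Type w} [AddCommGroup E] [Module k E] [Module.Finite k E]

/-- A linear form on `E`, as a polynomial in the coordinates of the chosen basis of `E`. -/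
noncomputable def linearFormPoly (f : E →ₗ[k] k) : MvPolynomial (Fin (Module.finrank k E)) k :=
  ∑ i, MvPolynomial.C (f (Module.finBasis k E i)) * MvPolynomial.X i

theorem linearFormPoly_mem (f : E →ₗ[k] k) : linearFormPoly f ∈ coordGrading k E 1 :=
  Submodule.sum_mem _ fun i _ => (MvPolynomial.mem_homogeneousSubmodule 1 _).mpr (by
    simpa using (MvPolynomial.isHomogeneous_C _ (f (Module.finBasis k E i))).mul
      (MvPolynomial.isHomogeneous_X k i))

theorem evalAt_linearFormPoly (f : E →ₗ[k] k) {K : Type u} [Field K] [Algebra k K]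
    (s : K ⊗[k] E) :
    evalAt s (linearFormPoly f) = TensorProduct.rid k K (f.lTensor K s) := by
  induction s with
  | zero => simp [evalAt, linearFormPoly]
  | add s t hs ht =>
    rw [map_add, map_add, ← hs, ← ht]
    simp [evalAt, linearFormPoly, mul_add, Finset.sum_add_distrib]
  | tmul c e =>
    have he := congrArg (fun e => algebraMap k K (f e) * c) ((Module.finBasis k E).sum_repr e)
    simp only [map_sum, map_smul, smul_eq_mul, map_mul, Finset.sum_mul] at he
    simp only [evalAt, linearFormPoly, map_sum, map_mul, MvPolynomial.aeval_X,
      MvPolynomial.algHom_C, Module.Basis.baseChange_repr_tmul, LinearMap.lTensor_tmul,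
      TensorProduct.rid_tmul, Algebra.smul_def]
    rw [← he]
    exact Finset.sum_congr rfl fun i _ => by ring

/-- The open set of the lines in `E` on which a linear form does not vanish. -/
noncomputable def nonvanishingOpen (f : E →ₗ[k] k) : (projSpace k E).left.Opens :=
  Proj.basicOpen (coordGrading k E) (linearFormPoly f)

theorem linePoint_mem_nonvanishingOpen_iff (f : E →ₗ[k] k) {K : Type u} [Field K] [Algebra k K]
    (s : K ⊗[k] E) (hs : s ≠ 0) :
    (linePoint s hs).left (IsLocalRing.closedPoint K) ∈ nonvanishingOpen f ↔ f.lTensor K s ≠ 0 := by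
  have h : (linePoint s hs).left ⁻¹ᵁ Proj.basicOpen (coordGrading k E) (linearFormPoly f) =
      (Spec (CommRingCat.of K)).basicOpen (evalAtΓ s (linearFormPoly f)) :=
    Proj.fromOfGlobalSections_preimage_basicOpen _ _ _ one_pos (linearFormPoly_mem f)
  change IsLocalRing.closedPoint K ∈ (linePoint s hs).left ⁻¹ᵁ
    Proj.basicOpen (coordGrading k E) (linearFormPoly f) ↔ _
  rw [h]
  change IsLocalRing.closedPoint K ∈ (Spec (CommRingCat.of K)).basicOpen
    ((Scheme.ΓSpecIso (CommRingCat.of K)).inv (evalAt s (linearFormPoly f))) ↔ _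
  rw [basicOpen_eq_of_affine, evalAt_linearFormPoly]
  change TensorProduct.rid k K (f.lTensor K s) ∉ IsLocalRing.maximalIdeal K ↔ _
  rw [IsLocalRing.maximalIdeal_eq_bot, Ideal.mem_bot, EmbeddingLike.map_eq_zero_iff]

end LinearForms

section ClosedConditions

variable {k : Type u} [Field k] {Q : Type v} [Quiver.{z} Q]
variable {V : QuiverRep.{u, v, w, z} k Q} [∀ x, Module.Finite k (V.space x)]

/-- The projection of the product of projective spaces to one of its factors. -/
noncomputable def projProductProj (H : Finset Q) (x : H) :
    projProduct V H ⟶ projSpace k (V.space x) :=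
  Pi.π (fun x : H => projSpace k (V.space x)) x

/-- The point of a tuple projects to the point of each of its lines. -/
theorem Tuple.projProductProj_point {H : Finset Q} {K : Type u} [Field K] [Algebra k K] (s : Tuple V H K)
    (x : H) :
    (projProductProj H x).left s.point =
      (linePoint (E := V.space x) (s.vec x) (s.ne_zero x)).left (IsLocalRing.closedPoint K) := by
  have h : s.toHom ≫ projProductProj H x =
      linePoint (E := V.space x) (s.vec x) (s.ne_zero x) := limit.lift_π _ _
  rw [← h]
  rfl

/-- The locus in the product of projective spaces at which `f` vanishes on the line with
index `x`. The vanishing of `f` is expressed by that of all linear forms composed with `f`. -/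
def vanishingLocus (H : Finset Q) (x : H) {F : Type*} [AddCommGroup F] [Module k F]
    (f : V.space x →ₗ[k] F) : Set (projProduct V H).left :=
  ⋂ ξ : Module.Dual k F, (projProductProj H x).left ⁻¹'
    (nonvanishingOpen (ξ ∘ₗ f) : Set (projSpace k (V.space x)).left)ᶜ

theorem isClosed_vanishingLocus (H : Finset Q) (x : H) {F : Type*} [AddCommGroup F] [Module k F]
    (f : V.space x →ₗ[k] F) : IsClosed (vanishingLocus H x f) :=
  isClosed_iInter fun ξ => (nonvanishingOpen (ξ ∘ₗ f)).isOpen.isClosed_compl.preimage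
    (Scheme.Hom.continuous _)

/-- Base change is compatible with the coordinates of a basis, so that a vector of `K ⊗ F` is
zero once all linear forms on `F` vanish on it. -/
theorem eq_zero_of_forall_dual {F : Type*} [AddCommGroup F] [Module k F] {K : Type u} [Field K]
    [Algebra k K] (t : K ⊗[k] F) (ht : ∀ ξ : Module.Dual k F, ξ.lTensor K t = 0) : t = 0 := by
  let b := Module.Basis.ofVectorSpace k F
  have h : ∀ (i) (t : K ⊗[k] F),
      (b.baseChange K).repr t i = TensorProduct.rid k K ((b.coord i).lTensor K t) := by
    intro i t
    induction t with
    | zero => simp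
    | add s t hs ht => simp [hs, ht]
    | tmul c e => simp [Algebra.smul_def, mul_comm]
  refine (b.baseChange K).repr.map_eq_zero_iff.mp (Finsupp.ext fun i => ?_)
  rw [h, ht, map_zero, Finsupp.zero_apply]

theorem Tuple.point_mem_vanishingLocus_iff {H : Finset Q} {K : Type u} [Field K] [Algebra k K]
    (s : Tuple V H K) (x : H) {F : Type*} [AddCommGroup F] [Module k F]
    (f : V.space x →ₗ[k] F) :
    s.point ∈ vanishingLocus H x f ↔ f.baseChange K (s.vec x) = 0 := by
  have h : s.point ∈ vanishingLocus H x f ↔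
      ∀ ξ : Module.Dual k F, ξ.lTensor K (f.baseChange K (s.vec x)) = 0 := by
    rw [vanishingLocus, Set.mem_iInter]
    refine forall_congr' fun ξ => ?_
    rw [Set.mem_preimage, Set.mem_compl_iff, s.projProductProj_point x, SetLike.mem_coe]
    refine (linePoint_mem_nonvanishingOpen_iff _ _ (s.ne_zero x)).not_left.trans ?_
    rw [LinearMap.lTensor_comp]
    rfl
  rw [h]
  exact ⟨eq_zero_of_forall_dual _, fun h0 ξ => by rw [h0, map_zero]⟩

end ClosedConditions

/-! ### Components of the linked projective space -/

section Components

variable {k : Type u} [Field k] {Q : Type v} [Quiver.{z} Q] {n : ℕ} {τ : ArrowTypes Q n}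
variable {V : QuiverRep.{u, v, w, z} k Q} [∀ x, Module.Finite k (V.space x)]

/-- On the component of `x`, the lines transported to a vertex `u` are killed by the map along
each path of positive length from `u` to `x`: on the dense subset, the line at `u` comes from `x`,
and the map along a circuit of positive length is zero. -/
theorem LPComponent_subset_vanishingLocus (hQ : IsZnQuiver τ) (hV : V.IsWeaklyLinkedNet τ)
    (H : Finset Q) {x u : Q} (w : H) (σ : Quiver.Path (w : Q) u) (α : Quiver.Path u x)
    (hα : pathType τ α ≠ 0) {p : LPLocus V τ H} (hp : p ∈ LPComponent V τ H x) :
    p.1 ∈ vanishingLocus H w (V.pathMap α ∘ₗ V.pathMap σ) := by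
  have hcl : IsClosed ((↑) ⁻¹' vanishingLocus H w (V.pathMap α ∘ₗ V.pathMap σ) :
      Set (LPLocus V τ H)) := (isClosed_vanishingLocus H w _).preimage continuous_subtype_val
  refine closure_minimal ?_ hcl hp
  rintro q ⟨K, _, _, s, hs, W, -, hW, hWgen⟩
  rw [Set.mem_preimage, ← hs, s.point_mem_vanishingLocus_iff, LinearMap.baseChange_comp,
    ← QuiverRep.pathMap_baseChange, ← QuiverRep.pathMap_baseChange]
  refine QuiverRep.Subrep.apply_eq_zero_of_generatedBy hWgen ((V.baseChange K).pathMap α)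
    (fun γ => ?_) _ (W.pathMap_mem σ _ ?_)
  · rw [← QuiverRep.pathMap_comp, QuiverRep.pathMap_baseChange, QuiverRep.pathMap_comp,
      hV.comp_pathMap_eq_zero hQ α hα γ, LinearMap.baseChange_zero]
    rfl
  · rw [hW w]
    exact Submodule.mem_span_singleton_self _

/-- Two linear maps with trivially intersecting kernels keep this property after an extension of
scalars, because the pair of them has a left inverse. -/
theorem eq_zero_of_baseChange_eq_zero {E F G : Type*} [AddCommGroup E] [Module k E]
    [AddCommGroup F] [Module k F] [AddCommGroup G] [Module k G] (f : E →ₗ[k] F) (g : E →ₗ[k] G)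
    (h : LinearMap.ker f ⊓ LinearMap.ker g = ⊥) {K : Type u} [Field K] [Algebra k K]
    (t : K ⊗[k] E) (hf : f.baseChange K t = 0) (hg : g.baseChange K t = 0) : t = 0 := by
  obtain ⟨r, hr⟩ := (f.prod g).exists_leftInverse_of_injective (by rw [LinearMap.ker_prod, h])
  have hsum : (r ∘ₗ LinearMap.inl k F G) ∘ₗ f + (r ∘ₗ LinearMap.inr k F G) ∘ₗ g =
      LinearMap.id := by
    rw [← hr]
    ext e
    simp [← map_add]
  have := LinearMap.congr_fun (congrArg (LinearMap.baseChange K) hsum) t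
  rw [LinearMap.baseChange_add, LinearMap.baseChange_comp, LinearMap.baseChange_comp _ (f := g),
    LinearMap.baseChange_id] at this
  simpa [hf, hg] using this.symm

/-- Distinct vertices whose components meet are neighbors. -/
theorem areNeighbors_of_mem_LPComponent (hQ : IsZnQuiver τ) (hV : V.IsLinkedNet τ)
    (hpure : V.IsPure) (H : Finset Q) (hH : hull τ (H : Set Q) = H)
    (hgen : V.GeneratedBy (H : Set Q)) (hne : H.Nonempty) {x y : Q} (hxy : x ≠ y)
    {p : LPLocus V τ H} (hx : p ∈ LPComponent V τ H x) (hy : p ∈ LPComponent V τ H y) :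
    AreNeighbors τ x y := by
  by_contra hnb
  obtain ⟨u, α, β, hα, hβ, hα0, hβ0, hαβ⟩ := hQ.exists_separating_vertex hxy hnb
  obtain ⟨w, hw, σ, hσ⟩ := QuiverRep.exists_bijective_pathMap hQ hV.toIsWeaklyLinkedNet hpure
    H hH hgen hne u
  obtain ⟨K, _, _, s, -, hs⟩ := p.2
  have h₁ := LPComponent_subset_vanishingLocus hQ hV.toIsWeaklyLinkedNet H ⟨w, hw⟩ σ α hα0 hx
  have h₂ := LPComponent_subset_vanishingLocus hQ hV.toIsWeaklyLinkedNet H ⟨w, hw⟩ σ β hβ0 hy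
  rw [← hs, s.point_mem_vanishingLocus_iff] at h₁ h₂
  refine s.ne_zero ⟨w, hw⟩ (eq_zero_of_baseChange_eq_zero _ _ ?_ _ h₁ h₂)
  rw [LinearMap.ker_comp, LinearMap.ker_comp, ← Submodule.comap_inf,
    hV.ker_inf_ker α β hα hβ hαβ]
  exact LinearMap.ker_eq_bot.mpr hσ.1

end Components

end LinkedNet

theorem mainTheorem9 {k : Type u} [Field k] {Q : Type v} [Quiver.{z} Q] {n : ℕ}
    (τ : LinkedNet.ArrowTypes Q n) (hQ : LinkedNet.IsZnQuiver τ)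
    (V : LinkedNet.QuiverRep.{u, v, w, z} k Q) [∀ x, Module.Finite k (V.space x)]
    (hpure : V.IsPure) (hnontrivial : V.IsNontrivial) (hexact : V.IsExact τ)
    (hfg : V.IsFinitelyGenerated) (hlinked : V.IsLinkedNet τ)
    (H : Finset Q) (hH : LinkedNet.hull τ (H : Set Q) = H) (hgen : V.GeneratedBy (H : Set Q))
    (m : ℕ) (hm : 1 ≤ m) (x : Fin m → Q) (hx : Function.Injective x)
    (hne : (⋂ i, LinkedNet.LPComponent V τ H (x i)).Nonempty) :
    LinkedNet.IsPolygon τ (Set.range x) := by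
  obtain ⟨p, hp⟩ := hne
  rw [Set.mem_iInter] at hp
  have hHne : H.Nonempty := by
    obtain ⟨y, hy⟩ := hnontrivial
    rw [Finset.nonempty_iff_ne_empty]
    rintro rfl
    exact bot_ne_top (α := Submodule k (V.space y)) (by simpa using hgen y)
  refine ⟨⟨x ⟨0, hm⟩, Set.mem_range_self _⟩, ?_⟩
  rintro _ ⟨i, rfl⟩ _ ⟨j, rfl⟩ hij
  exact LinkedNet.areNeighbors_of_mem_LPComponent hQ hlinked hpure H hH hgen hHne hij (hp i) (hp j)
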